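/- Let $\mathcal A$ be an additive category with an exact structure in the sense of Quillen, i.e. a distinguished class of kernel–cokernel pairs $B\rightarrowtail X\twoheadrightarrow A$, called short exact sequences, satisfying Quillen's axioms. Let $\mathrm{Iso}\,\mathcal A$ be the set of isomorphism classes $[X]$ of objects of $\mathcal A$, a commutative monoid under $[X]+[Y]=[X\oplus Y]$, and let $\mathrm{Ind}\,\mathcal A\subset \mathrm{Iso}\,\mathcal A$ be the subset of classes of indecomposable objects (non-zero objects $X$ such that $X\cong Y\oplus Z$ implies $Y\cong 0$ or $Z\cong 0$). Assume that $\mathcal A$ is finitary: all sets $\mathrm{Hom}_{\mathcal A}(X,Y)$ are finite and, for all $A,B\in\mathcal A$, there are only finitely many classes $[X]$ for which a short exact sequence $B\rightarrowtail X\twoheadrightarrow A$ exists. The Hall algebra $H_{\mathcal A}$ is the associative unital $\mathbb Q$-algebra with $\mathbb Q$-basis $\mathrm{Iso}\,\mathcal A$, product $$[A]\cdot[B]=\sum_{[X]\in \mathrm{Iso}\,\mathcal A}F_{A,B}^X\,[X],$$ and unit $[0]$, where $F_{A,B}^X$ is the number of orbits of $\mathrm{Aut}\,A\times \mathrm{Aut}\,B$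 on the set of short exact sequences $B\xrightarrow{f}X\xrightarrow{g}A$, acting by $(\psi,\varphi)\cdot(f,g)=(f\varphi^{-1},\psi g)$. Then: 1. For any total order $\le$ on $\mathrm{Ind}\,\mathcal A$, the ordered monomials $[X_1]\cdots[X_k]$ with $k\ge 0$, $[X_i]\in\mathrm{Ind}\,\mathcal A$ and $[X_1]\le\cdots\le[X_k]$ span $H_{\mathcal A}$ as a $\mathbb Q$-vector space. In particular, $H_{\mathcal A}$ is generated as a $\mathbb Q$-algebra by $\mathrm{Ind}\,\mathcal A$. 2. If moreover $\mathcal A$ is Krull–Schmidt, i.e. the commutative monoid $\mathrm{Iso}\,\mathcal A$ is freely generated by $\mathrm{Ind}\,\mathcal A$, then for any total order on $\mathrm{Ind}\,\mathcal A$ these ordered monomials (indexed by the finite multisets of elements of $\mathrm{Ind}\,\mathcal A$) form a basis of $H_{\mathcal A}$. -/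

import Mathlib

open CategoryTheory CategoryTheory.Limits
open scoped ZeroObject

universe v u

namespace HallPBW

section Exact

variable {C : Type u} [Category.{v} C] [Preadditive C]

/-- The first morphisms of the short complexes in the class `P`. -/
def IsInflationOf (P : ObjectProperty (ShortComplex C)) {X Y : C} (f : X ⟶ Y) : Prop :=
  ∃ (Z : C) (g : Y ⟶ Z) (w : f ≫ g = 0), P (ShortComplex.mk f g w)

/-- The second morphisms of the short complexes in the class `P`. -/
def IsDeflationOf (P : ObjectProperty (ShortComplex C)) {Y Z : C} (g : Y ⟶ Z) : Prop :=
  ∃ (X : C) (f : X ⟶ Y) (w : f ≫ g = 0), P (ShortComplex.mk f g w)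

end Exact

/-- A Quillen exact structure on an additive category: a class of kernel-cokernel pairs
(the short exact sequences of the structure), closed under isomorphism, such that identities are
inflations and deflations, inflations and deflations are closed under composition, inflations are
stable under pushout along arbitrary morphisms and deflations are stable under pullback along
arbitrary morphisms (and these pushouts and pullbacks exist). -/
structure ExactStructure (C : Type u) [Category.{v} C] [Preadditive C]
    [HasZeroObject C] [HasBinaryBiproducts C] where
  /-- the short exact sequences of the exact structure -/
  conflation : ObjectProperty (ShortComplex C)
  of_iso : ∀ {S T : ShortComplex C}, (S ≅ T) → conflation S → conflation T
  isKernel : ∀ {S : ShortComplex C}, conflation S →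
    Nonempty (IsLimit (KernelFork.ofι S.f S.zero))
  isCokernel : ∀ {S : ShortComplex C}, conflation S →
    Nonempty (IsColimit (CokernelCofork.ofπ S.g S.zero))
  id_inflation : ∀ X : C, IsInflationOf conflation (𝟙 X)
  id_deflation : ∀ X : C, IsDeflationOf conflation (𝟙 X)
  comp_inflation : ∀ {X Y Z : C} (f : X ⟶ Y) (g : Y ⟶ Z),
    IsInflationOf conflation f → IsInflationOf conflation g → IsInflationOf conflation (f ≫ g)
  comp_deflation : ∀ {X Y Z : C} (f : X ⟶ Y) (g : Y ⟶ Z),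
    IsDeflationOf conflation f → IsDeflationOf conflation g → IsDeflationOf conflation (f ≫ g)
  pushout_inflation : ∀ {X Y X' : C} (f : X ⟶ Y) (g : X ⟶ X'), IsInflationOf conflation f →
    ∃ (Y' : C) (g' : Y ⟶ Y') (f' : X' ⟶ Y'), IsPushout f g g' f' ∧ IsInflationOf conflation f'
  pullback_deflation : ∀ {Y Z Z' : C} (g : Y ⟶ Z) (h : Z' ⟶ Z), IsDeflationOf conflation g →
    ∃ (Y' : C) (h' : Y' ⟶ Y) (g' : Y' ⟶ Z'), IsPullback h' g' g h ∧ IsDeflationOf conflation g'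

set_option linter.unusedSectionVars false

section IsoClasses

/-- The set of isomorphism classes of objects of `C`. -/
def IsoClass (C : Type u) [Category.{v} C] : Type u := Quotient (isIsomorphicSetoid C)

variable {C : Type u} [Category.{v} C]

/-- The isomorphism class of an object. -/
def isoClass (X : C) : IsoClass C := Quotient.mk (isIsomorphicSetoid C) X

/-- A chosen representative of an isomorphism class. -/
noncomputable def IsoClass.rep (x : IsoClass C) : C :=
  @Quotient.out C (isIsomorphicSetoid C) x

@[simp]
theorem isoClass_rep (x : IsoClass C) : isoClass x.rep = x :=
  @Quotient.out_eq C (isIsomorphicSetoid C) x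

theorem isoClass_eq_iff {X Y : C} : isoClass X = isoClass Y ↔ Nonempty (X ≅ Y) :=
  @Quotient.eq C (isIsomorphicSetoid C) X Y

theorem isoClass_surjective : Function.Surjective (isoClass : C → IsoClass C) :=
  fun x => ⟨x.rep, isoClass_rep x⟩

variable [Preadditive C] [HasZeroObject C] [HasBinaryBiproducts C]

/-- The monoid structure `[X] + [Y] = [X ⊕ Y]` on isomorphism classes. -/
noncomputable instance : Add (IsoClass C) where
  add := @Quotient.map₂ C C (isIsomorphicSetoid C) (isIsomorphicSetoid C) C (isIsomorphicSetoid C)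
    (fun X Y => X ⊞ Y) (fun _ _ ⟨e⟩ _ _ ⟨f⟩ => ⟨biprod.mapIso e f⟩)

noncomputable instance : Zero (IsoClass C) where
  zero := isoClass (0 : C)

theorem isoClass_biprod (X Y : C) : isoClass (X ⊞ Y) = isoClass X + isoClass Y := rfl

theorem isoClass_zero : isoClass (0 : C) = 0 := rfl

noncomputable instance : AddCommMonoid (IsoClass C) where
  add_assoc x y z := by
    obtain ⟨X, rfl⟩ := isoClass_surjective x
    obtain ⟨Y, rfl⟩ := isoClass_surjective y
    obtain ⟨Z, rfl⟩ := isoClass_surjective z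
    exact isoClass_eq_iff.2 ⟨biprod.associator X Y Z⟩
  zero_add x := by
    obtain ⟨X, rfl⟩ := isoClass_surjective x
    exact isoClass_eq_iff.2 ⟨(isoZeroBiprod (isZero_zero C)).symm⟩
  add_zero x := by
    obtain ⟨X, rfl⟩ := isoClass_surjective x
    exact isoClass_eq_iff.2 ⟨(isoBiprodZero (isZero_zero C)).symm⟩
  add_comm x y := by
    obtain ⟨X, rfl⟩ := isoClass_surjective x
    obtain ⟨Y, rfl⟩ := isoClass_surjective y
    exact isoClass_eq_iff.2 ⟨biprod.braiding X Y⟩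
  nsmul := nsmulRec

variable (C) in
/-- The set of isomorphism classes of indecomposable objects. -/
def IndClass : Type u := {x : IsoClass C // ∃ X : C, Indecomposable X ∧ isoClass X = x}

variable (C) in
/-- `C` is Krull-Schmidt if the monoid of isomorphism classes is freely generated, as a
commutative monoid, by the classes of indecomposable objects. -/
def IsKrullSchmidt : Prop :=
  Function.Bijective (fun m : Multiset (IndClass C) => (m.map Subtype.val).sum)

end IsoClasses

section Hall

variable {C : Type u} [Category.{v} C] [Preadditive C] [HasZeroObject C] [HasBinaryBiproducts C]

namespace ExactStructure

variable (E : ExactStructure C)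

/-- `B ⟶ X ⟶ A` is a short exact sequence of the exact structure. -/
def Conf {B X A : C} (f : B ⟶ X) (g : X ⟶ A) : Prop :=
  ∃ w : f ≫ g = 0, E.conflation (ShortComplex.mk f g w)

/-- The set of short exact sequences `B ⟶ X ⟶ A` with fixed objects. -/
@[ext]
structure Seq (A B X : C) where
  f : B ⟶ X
  g : X ⟶ A
  conf : E.Conf f g

/-- The set of classes `[X]` such that there is a short exact sequence `B ⟶ X ⟶ A`. -/
def extClasses (A B : C) : Set (IsoClass C) := {x | ∃ X : C, isoClass X = x ∧ Nonempty (E.Seq A B X)}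

/-- An exact category is finitary if its sets of morphisms are finite and, for all `A` and `B`,
only finitely many isomorphism classes of objects occur as middle terms of short exact sequences
`B ⟶ X ⟶ A`. -/
class IsFinitary : Prop where
  finite_hom : ∀ X Y : C, Finite (X ⟶ Y)
  finite_ext : ∀ A B : C, (E.extClasses A B).Finite

variable {E}

theorem Conf.w {B X A : C} {f : B ⟶ X} {g : X ⟶ A} (h : E.Conf f g) : f ≫ g = 0 := h.1

theorem Conf.mono {B X A : C} {f : B ⟶ X} {g : X ⟶ A} (h : E.Conf f g) : Mono f := by
  obtain ⟨l⟩ := E.isKernel h.2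
  exact ⟨fun a b hab => Fork.IsLimit.hom_ext l hab⟩

theorem Conf.epi {B X A : C} {f : B ⟶ X} {g : X ⟶ A} (h : E.Conf f g) : Epi g := by
  obtain ⟨l⟩ := E.isCokernel h.2
  exact ⟨fun a b hab => Cofork.IsColimit.hom_ext l hab⟩

theorem Conf.exists_lift {B X A T : C} {f : B ⟶ X} {g : X ⟶ A} (h : E.Conf f g) (t : T ⟶ X)
    (ht : t ≫ g = 0) : ∃ l : T ⟶ B, l ≫ f = t := by
  obtain ⟨l⟩ := E.isKernel h.2
  exact ⟨l.lift (KernelFork.ofι t ht), l.fac _ WalkingParallelPair.zero⟩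

theorem Conf.exists_desc {B X A T : C} {f : B ⟶ X} {g : X ⟶ A} (h : E.Conf f g) (t : X ⟶ T)
    (ht : f ≫ t = 0) : ∃ l : A ⟶ T, g ≫ l = t := by
  obtain ⟨l⟩ := E.isCokernel h.2
  exact ⟨l.desc (CokernelCofork.ofπ t ht), l.fac _ WalkingParallelPair.one⟩

theorem Conf.congr {B X A B' X' A' : C} {f : B ⟶ X} {g : X ⟶ A} {f' : B' ⟶ X'} {g' : X' ⟶ A'}
    (h : E.Conf f g) (b : B ≅ B') (x : X ≅ X') (a : A ≅ A') (hf : f ≫ x.hom = b.hom ≫ f')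
    (hg : g ≫ a.hom = x.hom ≫ g') : E.Conf f' g' := by
  have w : f' ≫ g' = 0 := by
    rw [← cancel_epi b.hom, ← Category.assoc, ← hf, Category.assoc, ← hg, ← Category.assoc, h.w]
    simp
  exact ⟨w, E.of_iso (ShortComplex.isoMk b x a hf.symm hg.symm) h.2⟩

/-- A kernel of a deflation completes it to a short exact sequence. -/
theorem Conf.of_kernel {B X A B' : C} {f : B ⟶ X} {g : X ⟶ A} (h : E.Conf f g) {f' : B' ⟶ X}
    [Mono f'] (w : f' ≫ g = 0) (t : B ⟶ B') (ht : t ≫ f' = f) : E.Conf f' g := by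
  obtain ⟨l, hl⟩ := h.exists_lift f' w
  have := h.mono
  refine h.congr ⟨t, l, ?_, ?_⟩ (Iso.refl X) (Iso.refl A) (by simp [ht]) (by simp)
  · rw [← cancel_mono f]; simp [hl, ht]
  · rw [← cancel_mono f']; simp [hl, ht]

/-- A cokernel of an inflation completes it to a short exact sequence. -/
theorem Conf.of_cokernel {B X A A' : C} {f : B ⟶ X} {g : X ⟶ A} (h : E.Conf f g) {g' : X ⟶ A'}
    [Epi g'] (w : f ≫ g' = 0) (t : A' ⟶ A) (ht : g' ≫ t = g) : E.Conf f g' := by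
  obtain ⟨l, hl⟩ := h.exists_desc g' w
  have := h.epi
  refine h.congr (Iso.refl B) (Iso.refl X) ⟨l, t, ?_, ?_⟩ (by simp) (by simp [hl])
  · rw [← cancel_epi g]; simp [reassoc_of% hl, ht]
  · rw [← cancel_epi g']; simp [reassoc_of% ht, hl]

theorem Conf.comp_iso {B X A B' A' : C} {f : B ⟶ X} {g : X ⟶ A} (h : E.Conf f g)
    (b : B' ≅ B) (a : A ≅ A') : E.Conf (b.hom ≫ f) (g ≫ a.hom) :=
  h.congr b.symm (Iso.refl X) a (by simp) (by simp)

theorem Conf.conj_iso {B X A X' : C} {f : B ⟶ X} {g : X ⟶ A} (h : E.Conf f g)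
    (x : X ≅ X') : E.Conf (f ≫ x.hom) (x.inv ≫ g) :=
  h.congr (Iso.refl B) x (Iso.refl A) (by simp) (by simp)

/-- The action of `Aut A × Aut B` on short exact sequences `B ⟶ X ⟶ A`:
`(ψ, φ) • (f, g) = (f φ⁻¹, ψ g)`. -/
instance (A B X : C) : MulAction (Aut A × Aut B) (E.Seq A B X) where
  smul p s := ⟨p.2.inv ≫ s.f, s.g ≫ p.1.hom, s.conf.comp_iso p.2.symm p.1⟩
  one_smul s := by
    ext
    · exact Category.id_comp _
    · exact Category.comp_id _
  mul_smul p q s := by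
    ext
    · exact Category.assoc _ _ _
    · exact (Category.assoc _ _ _).symm

theorem smul_f {A B X : C} (p : Aut A × Aut B) (s : E.Seq A B X) : (p • s).f = p.2.inv ≫ s.f := rfl

theorem smul_g {A B X : C} (p : Aut A × Aut B) (s : E.Seq A B X) : (p • s).g = s.g ≫ p.1.hom := rfl

variable (E) in
/-- The number of orbits of `Aut A × Aut B` on the set of short exact sequences `B ⟶ X ⟶ A`. -/
noncomputable def hallNumber (A B X : C) : ℕ :=
  Nat.card (MulAction.orbitRel.Quotient (Aut A × Aut B) (E.Seq A B X))

theorem stabilizer_eq_bot {A B X : C} (s : E.Seq A B X) :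
    MulAction.stabilizer (Aut A × Aut B) s = ⊥ := by
  rw [eq_bot_iff]
  rintro ⟨a, b⟩ h
  have h1 : b.inv ≫ s.f = s.f := congrArg Seq.f (MulAction.mem_stabilizer_iff.1 h)
  have h2 : s.g ≫ a.hom = s.g := congrArg Seq.g (MulAction.mem_stabilizer_iff.1 h)
  have := s.conf.mono
  have := s.conf.epi
  have h3 : b.inv = 𝟙 B := by rw [← cancel_mono s.f, h1, Category.id_comp]
  have h4 : a.hom = 𝟙 A := by rw [← cancel_epi s.g, h2, Category.comp_id]
  rw [Subgroup.mem_bot, Prod.ext_iff]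
  refine ⟨Iso.ext h4, ?_⟩
  have : b.symm = Iso.refl B := Iso.ext h3
  exact congrArg Iso.symm this

theorem card_seq (A B X : C) :
    Nat.card (E.Seq A B X) = E.hallNumber A B X * (Nat.card (Aut A) * Nat.card (Aut B)) := by
  rw [Nat.card_congr (MulAction.selfEquivOrbitsQuotientProd (G := Aut A × Aut B)
    (X := E.Seq A B X) stabilizer_eq_bot), Nat.card_prod, Nat.card_prod]
  rfl

/-- Sequences with isomorphic terms correspond to each other. -/
def seqEquiv {A B X A' B' X' : C} (a : A ≅ A') (b : B ≅ B') (x : X ≅ X') :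
    E.Seq A B X ≃ E.Seq A' B' X' where
  toFun s := ⟨b.inv ≫ s.f ≫ x.hom, (x.inv ≫ s.g) ≫ a.hom,
    (s.conf.conj_iso x).comp_iso b.symm a⟩
  invFun s := ⟨b.hom ≫ s.f ≫ x.inv, (x.hom ≫ s.g) ≫ a.inv,
    (s.conf.conj_iso x.symm).comp_iso b a.symm⟩
  left_inv s := by ext <;> simp
  right_inv s := by ext <;> simp

section Finitary

theorem finite_hom (E : ExactStructure C) [E.IsFinitary] (X Y : C) : Finite (X ⟶ Y) := IsFinitary.finite_hom E X Y

theorem finite_iso (E : ExactStructure C) [E.IsFinitary] (X Y : C) : Finite (X ≅ Y) :=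
  have := E.finite_hom X Y
  Finite.of_injective (fun e : X ≅ Y => e.hom) (fun _ _ h => Iso.ext h)

variable (E) [E.IsFinitary]

theorem finite_seq (A B X : C) : Finite (E.Seq A B X) :=
  have := E.finite_hom B X
  have := E.finite_hom X A
  Finite.of_injective (fun s : E.Seq A B X => (s.f, s.g)) fun s t h => by
    rw [Prod.mk.injEq] at h
    exact Seq.ext h.1 h.2

theorem card_aut_ne_zero (E : ExactStructure C) [E.IsFinitary] (X : C) : (Nat.card (Aut X) : ℚ) ≠ 0 := by
  have : Finite (Aut X) := E.finite_iso X X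
  exact_mod_cast Nat.card_pos.ne'

theorem hallNumber_eq (A B X : C) : (E.hallNumber A B X : ℚ) =
    Nat.card (E.Seq A B X) / (Nat.card (Aut A) * Nat.card (Aut B)) := by
  have h := E.card_aut_ne_zero A
  have h' := E.card_aut_ne_zero B
  rw [card_seq]
  push_cast
  field_simp

/-- A filtration of `Y` with subquotients `D`, `B`, `A` (bottom to top), recorded together with its
quotient `X` and its subobject `X'`. -/
structure Flag (E : ExactStructure C) (A B D Y X X' : C) where
  l₁ : E.Seq A B X
  l₂ : E.Seq X D Y
  r₁ : E.Seq B D X'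
  r₂ : E.Seq A X' Y
  comm₁ : l₂.g ≫ l₁.g = r₂.g
  comm₂ : r₁.f ≫ r₂.f = l₂.f
  comm₃ : r₂.f ≫ l₂.g = r₁.g ≫ l₁.f

theorem exists_left {E : ExactStructure C} {A B D Y X : C} (s : E.Seq A B X) (t : E.Seq X D Y) :
    ∃ (K : C) (k : K ⟶ Y) (e : D ⟶ K) (p : K ⟶ B), E.Conf k (t.g ≫ s.g) ∧ E.Conf e p ∧
      e ≫ k = t.f ∧ k ≫ t.g = p ≫ s.f := by
  obtain ⟨K, k, hk⟩ := E.comp_deflation t.g s.g ⟨_, _, t.conf⟩ ⟨_, _, s.conf⟩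
  have hk : E.Conf k (t.g ≫ s.g) := hk
  have := hk.mono
  have := t.conf.mono
  have := s.conf.mono
  obtain ⟨e, he⟩ := hk.exists_lift t.f (by rw [reassoc_of% t.conf.w, zero_comp])
  obtain ⟨p, hp⟩ := s.conf.exists_lift (k ≫ t.g) (by rw [Category.assoc, hk.w])
  refine ⟨K, k, e, p, hk, ?_, he, hp.symm⟩
  obtain ⟨P, h', g', hP, Q, f, hf⟩ := E.pullback_deflation t.g s.f ⟨_, _, t.conf⟩
  have hf : E.Conf f g' := hf
  obtain ⟨u, hu⟩ := hk.exists_lift h' (by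
    rw [← Category.assoc, hP.w, Category.assoc, s.conf.w, comp_zero])
  obtain ⟨v, hv1, hv2⟩ := hP.exists_lift k p hp.symm
  have hup : u ≫ p = g' := by
    rw [← cancel_mono s.f, Category.assoc, hp, reassoc_of% hu, hP.w]
  have hvu : v ≫ u = 𝟙 K := by rw [← cancel_mono k, Category.assoc, hu, hv1, Category.id_comp]
  have huv : u ≫ v = 𝟙 P := hP.hom_ext (by simp [hv1, hu]) (by simp [hv2, hup])
  have h2 : E.Conf (f ≫ u) p :=
    hf.congr (Iso.refl Q) ⟨u, v, huv, hvu⟩ (Iso.refl B) (by simp) (by simp [hup])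
  have : Mono e := by
    have : Mono (e ≫ k) := by rw [he]; infer_instance
    exact mono_of_mono e k
  obtain ⟨w, hw⟩ := t.conf.exists_lift (f ≫ h') (by
    rw [Category.assoc, hP.w, reassoc_of% hf.w, zero_comp])
  refine h2.of_kernel ?_ w ?_
  · rw [← cancel_mono s.f, Category.assoc, hp, reassoc_of% he, t.conf.w, zero_comp]
  · rw [← cancel_mono k, Category.assoc, he, hw, Category.assoc, hu]

theorem exists_right {E : ExactStructure C} {A B D Y X : C} (s : E.Seq B D X) (t : E.Seq A X Y) :
    ∃ (K : C) (k : Y ⟶ K) (p : B ⟶ K) (e : K ⟶ A), E.Conf (s.f ≫ t.f) k ∧ E.Conf p e ∧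
      k ≫ e = t.g ∧ t.f ≫ k = s.g ≫ p := by
  obtain ⟨K, k, hk⟩ := E.comp_inflation s.f t.f ⟨_, _, s.conf⟩ ⟨_, _, t.conf⟩
  have hk : E.Conf (s.f ≫ t.f) k := hk
  have := hk.epi
  have := t.conf.epi
  have := s.conf.epi
  obtain ⟨e, he⟩ := hk.exists_desc t.g (by rw [Category.assoc, t.conf.w, comp_zero])
  obtain ⟨p, hp⟩ := s.conf.exists_desc (t.f ≫ k) (by rw [← Category.assoc, hk.w])
  refine ⟨K, k, p, e, hk, ?_, he, hp.symm⟩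
  obtain ⟨P, h', f', hP, Q, g, hg⟩ := E.pushout_inflation t.f s.g ⟨_, _, t.conf⟩
  have hg : E.Conf f' g := hg
  obtain ⟨u, hu⟩ := hk.exists_desc h' (by
    rw [Category.assoc, hP.w, reassoc_of% s.conf.w, zero_comp])
  obtain ⟨v, hv1, hv2⟩ := hP.exists_desc k p hp.symm
  have hpu : p ≫ u = f' := by
    rw [← cancel_epi s.g, reassoc_of% hp, hu, hP.w]
  have huv : u ≫ v = 𝟙 K := by rw [← cancel_epi k, reassoc_of% hu, hv1, Category.comp_id]
  have hvu : v ≫ u = 𝟙 P := hP.hom_ext (by simp [reassoc_of% hv1, hu])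
    (by simp [reassoc_of% hv2, hpu])
  have h2 : E.Conf p (u ≫ g) :=
    hg.congr (Iso.refl B) ⟨v, u, hvu, huv⟩ (Iso.refl Q) (by simp [hv2])
      (by simp [reassoc_of% hvu])
  have : Epi e := by
    have : Epi (k ≫ e) := by rw [he]; infer_instance
    exact epi_of_epi k e
  obtain ⟨w, hw⟩ := t.conf.exists_desc (h' ≫ g) (by
    rw [← Category.assoc, hP.w, Category.assoc, hg.w, comp_zero])
  refine h2.of_cokernel ?_ w ?_
  · rw [← cancel_epi s.g, reassoc_of% hp, he, t.conf.w, comp_zero]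
  · rw [← cancel_epi k, reassoc_of% he, hw, reassoc_of% hu]

theorem card_fiber_left {E : ExactStructure C} {A B D Y X : C} (s : E.Seq A B X)
    (t : E.Seq X D Y) : ∃ K : C, isoClass K ∈ E.extClasses B D ∧ ∀ X' : C,
      Nonempty ((X' ≅ K) ≃ {z : E.Flag A B D Y X X' // (z.l₁, z.l₂) = (s, t)}) := by
  obtain ⟨K, k, e, p, hk, hep, he, hp⟩ := exists_left s t
  have := hk.mono
  have := s.conf.mono
  refine ⟨K, ⟨K, rfl, ⟨e, p, hep⟩⟩, fun X' => ⟨Equiv.ofBijective (fun α =>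
    ⟨⟨s, t, ⟨e ≫ α.inv, α.hom ≫ p, hep.conj_iso α.symm⟩, ⟨α.hom ≫ k, t.g ≫ s.g, ?_⟩,
      rfl, by simp [he], by simp [hp]⟩, rfl⟩) ⟨?_, ?_⟩⟩⟩
  · exact hk.congr α.symm (Iso.refl _) (Iso.refl _) (by simp) (by simp)
  · intro α β h
    have h1 : α.hom ≫ k = β.hom ≫ k := congrArg (fun z => z.1.r₂.f) h
    exact Iso.ext ((cancel_mono k).1 h1)
  · rintro ⟨⟨l₁, l₂, ⟨f₁, g₁, h₁⟩, ⟨f₂, g₂, h₂⟩, c₁, c₂, c₃⟩, h⟩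
    obtain ⟨rfl, rfl⟩ := Prod.mk.inj h
    dsimp only at c₁ c₂ c₃
    subst c₁
    have := h₂.mono
    obtain ⟨a, ha⟩ := hk.exists_lift f₂ h₂.w
    obtain ⟨b, hb⟩ := h₂.exists_lift k hk.w
    have hab : a ≫ b = 𝟙 X' := by rw [← cancel_mono f₂, Category.assoc, hb, ha, Category.id_comp]
    have hba : b ≫ a = 𝟙 K := by rw [← cancel_mono k, Category.assoc, ha, hb, Category.id_comp]
    have e1 : e ≫ b = f₁ := by rw [← cancel_mono f₂, Category.assoc, hb, he, c₂]
    have e2 : a ≫ p = g₁ := by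
      rw [← cancel_mono l₁.f, Category.assoc, ← hp, reassoc_of% ha, c₃]
    refine ⟨⟨a, b, hab, hba⟩, ?_⟩
    subst e1 e2 ha
    rfl

theorem card_fiber_right {E : ExactStructure C} {A B D Y X' : C} (s : E.Seq B D X')
    (t : E.Seq A X' Y) : ∃ K : C, isoClass K ∈ E.extClasses A B ∧ ∀ X : C,
      Nonempty ((X ≅ K) ≃ {z : E.Flag A B D Y X X' // (z.r₁, z.r₂) = (s, t)}) := by
  obtain ⟨K, k, p, e, hk, hep, he, hp⟩ := exists_right s t
  have := hk.epi
  have := s.conf.epi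
  refine ⟨K, ⟨K, rfl, ⟨p, e, hep⟩⟩, fun X => ⟨Equiv.ofBijective (fun α =>
    ⟨⟨⟨p ≫ α.inv, α.hom ≫ e, hep.conj_iso α.symm⟩, ⟨s.f ≫ t.f, k ≫ α.inv, ?_⟩, s, t,
      by simp [he], rfl, by simp [reassoc_of% hp]⟩, rfl⟩) ⟨?_, ?_⟩⟩⟩
  · exact hk.congr (Iso.refl _) (Iso.refl _) α.symm (by simp) (by simp)
  · intro α β h
    have h1 : k ≫ α.inv = k ≫ β.inv := congrArg (fun z => z.1.l₂.g) h
    exact Iso.ext_inv ((cancel_epi k).1 h1)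
  · rintro ⟨⟨⟨f₁, g₁, h₁⟩, ⟨f₂, g₂, h₂⟩, r₁, r₂, c₁, c₂, c₃⟩, h⟩
    obtain ⟨rfl, rfl⟩ := Prod.mk.inj h
    dsimp only at c₁ c₂ c₃
    subst c₂
    have := h₂.epi
    obtain ⟨a, ha⟩ := hk.exists_desc g₂ h₂.w
    obtain ⟨b, hb⟩ := h₂.exists_desc k hk.w
    have hab : a ≫ b = 𝟙 K := by rw [← cancel_epi k, reassoc_of% ha, hb, Category.comp_id]
    have hba : b ≫ a = 𝟙 X := by rw [← cancel_epi g₂, reassoc_of% hb, ha, Category.comp_id]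
    have e1 : b ≫ e = g₁ := by rw [← cancel_epi g₂, reassoc_of% hb, he, c₁]
    have e2 : p ≫ a = f₁ := by
      rw [← cancel_epi r₁.g, ← reassoc_of% hp, ha, c₃]
    refine ⟨⟨b, a, hba, hab⟩, ?_⟩
    subst e1 e2 ha
    rfl

theorem finite_flag (A B D Y X X' : C) : Finite (E.Flag A B D Y X X') := by
  have := E.finite_seq A B X
  have := E.finite_seq X D Y
  have := E.finite_seq B D X'
  have := E.finite_seq A X' Y
  refine Finite.of_injective (fun z : E.Flag A B D Y X X' => ((z.l₁, z.l₂), (z.r₁, z.r₂))) ?_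
  rintro ⟨⟩ ⟨⟩ h
  simp only [Prod.mk.injEq] at h
  obtain ⟨⟨rfl, rfl⟩, rfl, rfl⟩ := h
  rfl

theorem card_iso (X Y : C) [Decidable (Nonempty (X ≅ Y))] :
    Nat.card (X ≅ Y) = if Nonempty (X ≅ Y) then Nat.card (Aut X) else 0 := by
  split_ifs with h
  · obtain ⟨e⟩ := h
    exact Nat.card_congr ⟨fun f => f ≪≫ e.symm, fun f => Iso.trans f e, fun f => by ext; simp,
      fun f => by ext; exact (Category.assoc _ _ _).trans (by simp)⟩
  · have := not_nonempty_iff.1 h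
    simp

theorem card_eq_sum (E : ExactStructure C) [E.IsFinitary] {P : Type*} [Finite P] (S : Finset (IsoClass C)) (Q : IsoClass C → Type*)
    [∀ x, Finite (Q x)] (π : ∀ x, Q x → P) (h : ∀ p, ∃ K : C, isoClass K ∈ S ∧ ∀ x : IsoClass C,
      Nonempty ((x.rep ≅ K) ≃ {q : Q x // π x q = p})) :
    (Nat.card P : ℚ) = ∑ x ∈ S, (Nat.card (Q x) : ℚ) / Nat.card (Aut x.rep) := by
  classical
  have := Fintype.ofFinite P
  have key : ∀ x, (Nat.card (Q x) : ℚ) = ∑ p : P, (Nat.card {q : Q x // π x q = p} : ℚ) := by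
    intro x
    rw [← Nat.card_congr (Equiv.sigmaFiberEquiv (π x)), Nat.card_sigma]
    push_cast
    rfl
  simp_rw [key, Finset.sum_div]
  rw [Finset.sum_comm, Nat.card_eq_fintype_card, ← Finset.card_univ, Finset.card_eq_sum_ones]
  push_cast
  refine Finset.sum_congr rfl fun p _ => ?_
  obtain ⟨K, hK, hf⟩ := h p
  rw [Finset.sum_eq_single (isoClass K)]
  · obtain ⟨e⟩ := hf (isoClass K)
    have : Nonempty ((isoClass K).rep ≅ K) := isoClass_eq_iff.1 (isoClass_rep _)
    rw [← Nat.card_congr e, card_iso, if_pos this, div_self (E.card_aut_ne_zero _)]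
  · intro x _ hx
    obtain ⟨e⟩ := hf x
    have : ¬ Nonempty (x.rep ≅ K) := fun h => hx (by
      rw [← isoClass_rep x]; exact isoClass_eq_iff.2 h)
    rw [← Nat.card_congr e, card_iso, if_neg this]
    simp
  · exact fun h => absurd hK h

theorem hallNumber_assoc (A B D Y : C) :
    ∑ x ∈ (IsFinitary.finite_ext (E := E) A B).toFinset,
      (E.hallNumber A B x.rep : ℚ) * E.hallNumber x.rep D Y =
    ∑ x ∈ (IsFinitary.finite_ext (E := E) B D).toFinset,
      (E.hallNumber B D x.rep : ℚ) * E.hallNumber A x.rep Y := by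
  have hfin := E.finite_seq
  have hflag := E.finite_flag
  set S := (IsFinitary.finite_ext (E := E) A B).toFinset
  set T := (IsFinitary.finite_ext (E := E) B D).toFinset
  have hL : ∀ x : IsoClass C, (Nat.card (E.Seq A B x.rep) * Nat.card (E.Seq x.rep D Y) : ℚ) =
      ∑ y ∈ T, (Nat.card (E.Flag A B D Y x.rep y.rep) : ℚ) / Nat.card (Aut y.rep) := by
    intro x
    rw [← Nat.cast_mul, ← Nat.card_prod]
    refine E.card_eq_sum T (fun y => E.Flag A B D Y x.rep y.rep) (fun y z => (z.l₁, z.l₂)) ?_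
    rintro ⟨s, t⟩
    obtain ⟨K, hK, h⟩ := card_fiber_left s t
    exact ⟨K, by simpa [T] using hK, fun x => h _⟩
  have hR : ∀ y : IsoClass C, (Nat.card (E.Seq B D y.rep) * Nat.card (E.Seq A y.rep Y) : ℚ) =
      ∑ x ∈ S, (Nat.card (E.Flag A B D Y x.rep y.rep) : ℚ) / Nat.card (Aut x.rep) := by
    intro y
    rw [← Nat.cast_mul, ← Nat.card_prod]
    refine E.card_eq_sum S (fun x => E.Flag A B D Y x.rep y.rep) (fun x z => (z.r₁, z.r₂)) ?_
    rintro ⟨s, t⟩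
    obtain ⟨K, hK, h⟩ := card_fiber_right s t
    exact ⟨K, by simpa [S] using hK, fun x => h _⟩
  have hA := E.card_aut_ne_zero A
  have hB := E.card_aut_ne_zero B
  have hD := E.card_aut_ne_zero D
  set c : ℚ := Nat.card (Aut A) * Nat.card (Aut B) * Nat.card (Aut D)
  calc _ = ∑ x ∈ S, ∑ y ∈ T, (Nat.card (E.Flag A B D Y x.rep y.rep) : ℚ) /
        Nat.card (Aut y.rep) / Nat.card (Aut x.rep) / c := by
        refine Finset.sum_congr rfl fun x _ => ?_
        have hx := E.card_aut_ne_zero x.rep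
        rw [← Finset.sum_div, ← Finset.sum_div, ← hL, hallNumber_eq, hallNumber_eq]
        simp only [c]
        field_simp
    _ = ∑ y ∈ T, ∑ x ∈ S, (Nat.card (E.Flag A B D Y x.rep y.rep) : ℚ) /
        Nat.card (Aut x.rep) / Nat.card (Aut y.rep) / c := by
        rw [Finset.sum_comm]
        refine Finset.sum_congr rfl fun y _ => Finset.sum_congr rfl fun x _ => ?_
        rw [div_right_comm (Nat.card (E.Flag A B D Y x.rep y.rep) : ℚ)]
    _ = _ := by
        refine Finset.sum_congr rfl fun x _ => ?_
        have hx := E.card_aut_ne_zero x.rep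
        rw [← Finset.sum_div, ← Finset.sum_div, ← hR, hallNumber_eq, hallNumber_eq]
        simp only [c]
        field_simp

theorem hallNumber_congr {A B X A' B' X' : C} (a : A ≅ A') (b : B ≅ B') (x : X ≅ X') :
    E.hallNumber A B X = E.hallNumber A' B' X' := by
  have h : (E.hallNumber A B X : ℚ) = E.hallNumber A' B' X' := by
    rw [hallNumber_eq, hallNumber_eq, Nat.card_congr (seqEquiv a b x),
      Nat.card_congr (Aut.autMulEquivOfIso a).toEquiv,
      Nat.card_congr (Aut.autMulEquivOfIso b).toEquiv]
  exact_mod_cast h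

theorem hallNumber_ne_zero_iff (A B X : C) :
    E.hallNumber A B X ≠ 0 ↔ isoClass X ∈ E.extClasses A B := by
  have := E.finite_seq A B X
  have hA := E.card_aut_ne_zero A
  have hB := E.card_aut_ne_zero B
  have h : E.hallNumber A B X ≠ 0 ↔ Nat.card (E.Seq A B X) ≠ 0 := by
    rw [card_seq]
    norm_cast at hA hB
    simp [hA, hB]
  rw [h]
  constructor
  · intro h
    exact ⟨X, rfl, (Nat.card_ne_zero.1 h).1⟩
  · rintro ⟨X', hX', ⟨s⟩⟩
    obtain ⟨e⟩ := isoClass_eq_iff.1 hX'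
    exact Nat.card_ne_zero.2 ⟨⟨seqEquiv (Iso.refl A) (Iso.refl B) e s⟩, inferInstance⟩

theorem zero_eq_iff {X : C} : isoClass X = 0 ↔ IsZero X := by
  rw [← isoClass_zero, isoClass_eq_iff]
  exact ⟨fun ⟨e⟩ => (isZero_zero C).of_iso e, fun h => ⟨h.iso (isZero_zero C)⟩⟩

theorem card_aut_of_isZero {X : C} (h : IsZero X) : Nat.card (Aut X) = 1 :=
  Nat.card_eq_one_iff_unique.2 ⟨⟨fun _ _ => Iso.ext (h.eq_of_src _ _)⟩, ⟨1⟩⟩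

theorem hallNumber_zero_left {A : C} (hA : IsZero A) (B X : C) [Decidable (Nonempty (X ≅ B))] :
    E.hallNumber A B X = if Nonempty (X ≅ B) then 1 else 0 := by
  have h1 : Nat.card (E.Seq A B X) = Nat.card (X ≅ B) := by
    obtain ⟨Z, g, hg⟩ := E.id_inflation B
    have hg : E.Conf (𝟙 B) g := hg
    have := hg.epi
    have hZ : IsZero Z := by
      rw [IsZero.iff_id_eq_zero, ← cancel_epi g, comp_zero, Category.comp_id, ← hg.w,
        Category.id_comp]
    refine (Nat.card_congr (Equiv.ofBijective (fun e : X ≅ B => (⟨e.inv, 0,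
      hg.congr (Iso.refl B) e.symm (hZ.iso hA) (by simp) (hA.eq_of_tgt _ _)⟩ : E.Seq A B X))
      ⟨?_, ?_⟩)).symm
    · intro e e' h
      exact Iso.ext_inv (congrArg Seq.f h)
    · rintro ⟨f, g, h⟩
      have := h.mono
      obtain ⟨l, hl⟩ := h.exists_lift (𝟙 X) (hA.eq_of_tgt _ _)
      refine ⟨⟨l, f, hl, ?_⟩, Seq.ext rfl (hA.eq_of_tgt _ _)⟩
      rw [← cancel_mono f, Category.assoc, hl, Category.comp_id, Category.id_comp]
  have hB := E.card_aut_ne_zero B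
  rw [card_seq, card_iso, card_aut_of_isZero hA, one_mul] at h1
  norm_cast at hB
  split_ifs at h1 ⊢ with h
  · obtain ⟨e⟩ := h
    rw [Nat.card_congr (Aut.autMulEquivOfIso e).toEquiv] at h1
    exact Nat.eq_of_mul_eq_mul_right (Nat.pos_of_ne_zero hB) (by rw [h1, one_mul])
  · exact (Nat.mul_eq_zero.1 h1).resolve_right hB

theorem hallNumber_zero_right {B : C} (hB : IsZero B) (A X : C) [Decidable (Nonempty (X ≅ A))] :
    E.hallNumber A B X = if Nonempty (X ≅ A) then 1 else 0 := by
  have h1 : Nat.card (E.Seq A B X) = Nat.card (X ≅ A) := by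
    obtain ⟨Z, f, hf⟩ := E.id_deflation A
    have hf : E.Conf f (𝟙 A) := hf
    have := hf.mono
    have hZ : IsZero Z := by
      rw [IsZero.iff_id_eq_zero, ← cancel_mono f, zero_comp, Category.id_comp, ← hf.w,
        Category.comp_id]
    refine (Nat.card_congr (Equiv.ofBijective (fun e : X ≅ A => (⟨0, e.hom,
      hf.congr (hZ.iso hB) e.symm (Iso.refl A) (hZ.eq_of_src _ _) (by simp)⟩ : E.Seq A B X))
      ⟨?_, ?_⟩)).symm
    · intro e e' h
      exact Iso.ext (congrArg Seq.g h)
    · rintro ⟨f, g, h⟩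
      have := h.epi
      obtain ⟨l, hl⟩ := h.exists_desc (𝟙 X) (hB.eq_of_src _ _)
      refine ⟨⟨g, l, hl, ?_⟩, Seq.ext (hB.eq_of_src _ _) rfl⟩
      rw [← cancel_epi g, reassoc_of% hl, Category.comp_id]
  have hA := E.card_aut_ne_zero A
  rw [card_seq, card_iso, card_aut_of_isZero hB, mul_one] at h1
  norm_cast at hA
  split_ifs at h1 ⊢ with h
  · obtain ⟨e⟩ := h
    rw [Nat.card_congr (Aut.autMulEquivOfIso e).toEquiv] at h1
    exact Nat.eq_of_mul_eq_mul_right (Nat.pos_of_ne_zero hA) (by rw [h1, one_mul])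
  · exact (Nat.mul_eq_zero.1 h1).resolve_right hA

end Finitary
end ExactStructure

/-- The underlying vector space of the Hall algebra: the rational vector space with basis the set of
isomorphism classes of objects. -/
def HallAlgebra (_E : ExactStructure C) : Type u := IsoClass C →₀ ℚ

namespace HallAlgebra

variable (E : ExactStructure C)

noncomputable instance : AddCommGroup (HallAlgebra E) :=
  inferInstanceAs (AddCommGroup (IsoClass C →₀ ℚ))

noncomputable instance : Module ℚ (HallAlgebra E) :=
  inferInstanceAs (Module ℚ (IsoClass C →₀ ℚ))

/-- The basis of the Hall algebra formed by the isomorphism classes of objects. -/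
noncomputable def clsBasis : Module.Basis (IsoClass C) ℚ (HallAlgebra E) :=
  Module.Basis.ofRepr (LinearEquiv.refl ℚ (IsoClass C →₀ ℚ))

/-- The basis element of the Hall algebra given by an isomorphism class. -/
noncomputable def cls (x : IsoClass C) : HallAlgebra E := Finsupp.single x 1

theorem clsBasis_apply (x : IsoClass C) : clsBasis E x = cls E x := rfl

variable [E.IsFinitary]

theorem finite_support (a b : IsoClass C) :
    (Function.support fun x : IsoClass C => (E.hallNumber a.rep b.rep x.rep : ℚ)).Finite := by
  refine (ExactStructure.IsFinitary.finite_ext (E := E) a.rep b.rep).subset fun x hx => ?_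
  rw [Function.mem_support, Nat.cast_ne_zero, ExactStructure.hallNumber_ne_zero_iff,
    isoClass_rep] at hx
  exact hx

/-- The product `[A] [B] = ∑ F_{A,B}^X [X]` of two basis elements of the Hall algebra. -/
noncomputable def mulCls (a b : IsoClass C) : HallAlgebra E :=
  Finsupp.ofSupportFinite (fun x : IsoClass C => (E.hallNumber a.rep b.rep x.rep : ℚ))
    (finite_support E a b)

/-- The bilinear extension of the product of basis elements. -/
noncomputable def mulHom : HallAlgebra E →ₗ[ℚ] HallAlgebra E →ₗ[ℚ] HallAlgebra E :=
  (clsBasis E).constr ℚ fun a => (clsBasis E).constr ℚ fun b => mulCls E a b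

theorem mulHom_cls (a b : IsoClass C) : mulHom E (cls E a) (cls E b) = mulCls E a b := by
  rw [mulHom, ← clsBasis_apply, ← clsBasis_apply, Module.Basis.constr_basis,
    Module.Basis.constr_basis]

theorem mulCls_eq_sum (a b : IsoClass C) : mulCls E a b =
    ∑ x ∈ (ExactStructure.IsFinitary.finite_ext (E := E) a.rep b.rep).toFinset,
      (E.hallNumber a.rep b.rep x.rep : ℚ) • cls E x := by
  classical
  refine Finsupp.ext fun y => ?_
  have h : ∀ x : IsoClass C, ((E.hallNumber a.rep b.rep x.rep : ℚ) • cls E x) =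
    Finsupp.single x (E.hallNumber a.rep b.rep x.rep : ℚ) := fun x =>
      Finsupp.smul_single_one x _
  simp_rw [h]
  refine Eq.trans ?_ (Finsupp.finsetSum_apply (N := ℚ) _ _ y).symm
  simp only [Finsupp.single_apply, Finset.sum_ite_eq', Set.Finite.mem_toFinset]
  change (E.hallNumber a.rep b.rep y.rep : ℚ) = _
  split_ifs with hy
  · rfl
  · rw [Nat.cast_eq_zero]
    by_contra h0
    rw [← ne_eq, ExactStructure.hallNumber_ne_zero_iff, isoClass_rep] at h0
    exact hy h0

theorem mulCls_assoc (a b d : IsoClass C) :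
    mulHom E (mulCls E a b) (cls E d) = mulHom E (cls E a) (mulCls E b d) := by
  rw [mulCls_eq_sum, mulCls_eq_sum E b d]
  simp only [map_sum, map_smul, LinearMap.sum_apply, LinearMap.smul_apply, mulHom_cls]
  refine Finsupp.ext fun y => ?_
  refine (Finsupp.finsetSum_apply (N := ℚ) _ _ y).trans
    (Eq.trans ?_ (Finsupp.finsetSum_apply (N := ℚ) _ _ y).symm)
  exact ExactStructure.hallNumber_assoc E a.rep b.rep d.rep y.rep

theorem mulHom_assoc (x y z : HallAlgebra E) :
    mulHom E (mulHom E x y) z = mulHom E x (mulHom E y z) := by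
  have h1 : ∀ a b, mulHom E (mulHom E (cls E a) (cls E b)) z =
      mulHom E (cls E a) (mulHom E (cls E b) z) := fun a b => by
    refine LinearMap.congr_fun (f := mulHom E (mulHom E (cls E a) (cls E b)))
      (g := mulHom E (cls E a) ∘ₗ mulHom E (cls E b)) ((clsBasis E).ext fun d => ?_) z
    rw [clsBasis_apply, LinearMap.comp_apply, mulHom_cls, mulHom_cls, mulCls_assoc]
  have h2 : ∀ a, mulHom E (mulHom E (cls E a) y) z = mulHom E (cls E a) (mulHom E y z) :=
    fun a => by
      refine LinearMap.congr_fun (f := (mulHom E).flip z ∘ₗ mulHom E (cls E a))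
        (g := mulHom E (cls E a) ∘ₗ (mulHom E).flip z) ((clsBasis E).ext fun b => ?_) y
      rw [clsBasis_apply]
      exact h1 a b
  refine LinearMap.congr_fun (f := (mulHom E).flip z ∘ₗ (mulHom E).flip y)
    (g := (mulHom E).flip (mulHom E y z)) ((clsBasis E).ext fun a => ?_) x
  rw [clsBasis_apply]
  exact h2 a

theorem mulCls_zero_left (b : IsoClass C) : mulCls E 0 b = cls E b := by
  classical
  refine Finsupp.ext fun y => ?_
  have h0 : IsZero (IsoClass.rep (0 : IsoClass C)) :=
    ExactStructure.zero_eq_iff.1 (isoClass_rep _)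
  change (E.hallNumber (IsoClass.rep 0) b.rep y.rep : ℚ) = (Finsupp.single b (1 : ℚ)) y
  rw [E.hallNumber_zero_left h0, Finsupp.single_apply, ← isoClass_eq_iff, isoClass_rep,
    isoClass_rep]
  simp only [eq_comm (a := y)]
  split_ifs <;> simp

theorem mulCls_zero_right (a : IsoClass C) : mulCls E a 0 = cls E a := by
  classical
  refine Finsupp.ext fun y => ?_
  have h0 : IsZero (IsoClass.rep (0 : IsoClass C)) :=
    ExactStructure.zero_eq_iff.1 (isoClass_rep _)
  change (E.hallNumber a.rep (IsoClass.rep 0) y.rep : ℚ) = (Finsupp.single a (1 : ℚ)) y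
  rw [E.hallNumber_zero_right h0, Finsupp.single_apply, ← isoClass_eq_iff, isoClass_rep,
    isoClass_rep]
  simp only [eq_comm (a := y)]
  split_ifs <;> simp

/-- The Hall algebra is an associative ring with unit `[0]`. -/
noncomputable instance : Ring (HallAlgebra E) where
  __ := (inferInstance : AddCommGroup (HallAlgebra E))
  mul x y := mulHom E x y
  one := cls E 0
  left_distrib x y z := map_add (mulHom E x) y z
  right_distrib x y z := LinearMap.map_add₂ (mulHom E) x y z
  zero_mul x := LinearMap.map_zero₂ (mulHom E) x
  mul_zero x := map_zero (mulHom E x)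
  mul_assoc := mulHom_assoc E
  one_mul x := by
    refine LinearMap.congr_fun (f := mulHom E (cls E 0)) (g := LinearMap.id)
      ((clsBasis E).ext fun a => ?_) x
    rw [clsBasis_apply, mulHom_cls, mulCls_zero_left, LinearMap.id_apply]
  mul_one x := by
    refine LinearMap.congr_fun (f := (mulHom E).flip (cls E 0)) (g := LinearMap.id)
      ((clsBasis E).ext fun a => ?_) x
    rw [clsBasis_apply, LinearMap.flip_apply, mulHom_cls, mulCls_zero_right, LinearMap.id_apply]

noncomputable instance : Algebra ℚ (HallAlgebra E) :=
  Algebra.ofModule (fun r x y => LinearMap.map_smul₂ (mulHom E) r x y)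
    (fun r x y => map_smul (mulHom E x) r y)

theorem one_def : (1 : HallAlgebra E) = cls E 0 := rfl

theorem cls_mul_cls (a b : IsoClass C) : cls E a * cls E b = mulCls E a b := mulHom_cls E a b

/-- The coefficient of `[X]` in `[A] [B]` is the Hall number `F_{A,B}^X`. -/
theorem repr_cls_mul_cls (A B X : C) :
    (clsBasis E).repr (cls E (isoClass A) * cls E (isoClass B)) (isoClass X) =
      E.hallNumber A B X := by
  rw [cls_mul_cls]
  change (E.hallNumber (isoClass A).rep (isoClass B).rep (isoClass X).rep : ℚ) = _
  obtain ⟨a⟩ := isoClass_eq_iff.1 (isoClass_rep (isoClass A))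
  obtain ⟨b⟩ := isoClass_eq_iff.1 (isoClass_rep (isoClass B))
  obtain ⟨x⟩ := isoClass_eq_iff.1 (isoClass_rep (isoClass X))
  rw [E.hallNumber_congr a b x]

/-- The ordered monomial `[X₁] ⋯ [Xₖ]` with `X₁ ≤ ⋯ ≤ Xₖ` attached to a finite multiset of
indecomposable classes. -/
noncomputable def orderedMonomial [LinearOrder (IndClass C)] (m : Multiset (IndClass C)) :
    HallAlgebra E :=
  ((m.sort (· ≤ ·)).map fun i => cls E i.1).prod

end HallAlgebra
end Hall
end HallPBW

/-!
The theorem holds because the multiplication of the Hall algebra is triangular with respect to the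
addition of isomorphism classes. Write `h x y` for the number of morphisms from `x` to `y`. If
`B ⟶ X ⟶ A` is a short exact sequence, then left exactness of `Hom` gives
`h t X ≤ h t A * h t B` and `h X t ≤ h A t * h B t` for every `t`, that is, no hom number of `X`
exceeds the corresponding one of `A ⊞ B`. Taking `t = A`, the first inequality is an equality only
if the identity of `A` lifts to `X`, i.e. if the sequence splits; hence `X` has strictly fewer
endomorphisms than `A ⊞ B` unless `X ≅ A ⊞ B` (`homCard_self_lt_of_seq`).

Call `z` dominated by `x` if every hom number of `z` is at most that of `x` and `z` has strictly
fewer endomorphisms. This relation is compatible with addition, and therefore a product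
`[x₁] ⋯ [xₖ]` equals a non-zero multiple of `[x₁ + ⋯ + xₖ]` modulo the span of the classes
dominated by `x₁ + ⋯ + xₖ` (`exists_prod_cls_sub_mem_lower`). Since every class is a sum of
indecomposable ones (`exists_multiset_sum_eq`, again by counting endomorphisms), induction on the
number of endomorphisms shows that ordered monomials span. If the decomposition into indecomposables
is unique, then distinct ordered monomials have distinct leading classes, and looking at a leading
class with the most endomorphisms shows that no non-trivial linear relation exists.
-/

namespace HallPBW

/-! ### Counting in exact sequences of finite abelian groups -/

theorem card_eq_card_range_mul_card {G H K : Type*} [AddCommGroup G] [AddCommGroup H]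
    [AddCommGroup K] (f : G →+ H) (g : H →+ K) (hf : Function.Injective f)
    (hfg : f.range = g.ker) : Nat.card H = Nat.card g.range * Nat.card G := by
  rw [AddSubgroup.card_eq_card_quotient_mul_card_addSubgroup g.ker,
    Nat.card_congr (QuotientAddGroup.quotientKerEquivRange g).toEquiv, ← hfg,
    Nat.card_congr (AddMonoidHom.ofInjective hf).toEquiv]

variable {C : Type u} [Category.{v} C]

/-! ### Numbers of morphisms between isomorphism classes -/

/-- The number of morphisms between representatives of two isomorphism classes. -/
noncomputable def homCard (x y : IsoClass C) : ℕ := Nat.card (x.rep ⟶ y.rep)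

theorem homCard_isoClass (X Y : C) : homCard (isoClass X) (isoClass Y) = Nat.card (X ⟶ Y) := by
  obtain ⟨a⟩ := isoClass_eq_iff.1 (isoClass_rep (isoClass X))
  obtain ⟨b⟩ := isoClass_eq_iff.1 (isoClass_rep (isoClass Y))
  exact Nat.card_congr (a.homCongr b)

/-- `z` is dominated by `x` if no hom number of `z` exceeds that of `x`, and `z` has strictly fewer
endomorphisms. The first two conditions make the relation stable under addition, which comparing
endomorphisms alone would not be. -/
structure IsDominated (z x : IsoClass C) : Prop where
  left : ∀ t, homCard z t ≤ homCard x t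
  right : ∀ t, homCard t z ≤ homCard t x
  self : homCard z z < homCard x x

theorem IsDominated.trans {x y z : IsoClass C} (h : IsDominated x y) (h' : IsDominated y z) :
    IsDominated x z :=
  ⟨fun t => (h.left t).trans (h'.left t), fun t => (h.right t).trans (h'.right t),
    h.self.trans h'.self⟩

variable [Preadditive C] [HasZeroObject C] [HasBinaryBiproducts C]

theorem homCard_add_left (x y z : IsoClass C) :
    homCard (x + y) z = homCard x z * homCard y z := by
  obtain ⟨X, rfl⟩ := isoClass_surjective x
  obtain ⟨Y, rfl⟩ := isoClass_surjective y
  obtain ⟨Z, rfl⟩ := isoClass_surjective z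
  rw [← isoClass_biprod, homCard_isoClass, homCard_isoClass, homCard_isoClass, ← Nat.card_prod]
  exact Nat.card_congr ⟨fun f => (biprod.inl ≫ f, biprod.inr ≫ f), fun p => biprod.desc p.1 p.2,
    fun f => by ext <;> simp, fun p => by simp⟩

theorem homCard_add_right (x y z : IsoClass C) :
    homCard x (y + z) = homCard x y * homCard x z := by
  obtain ⟨X, rfl⟩ := isoClass_surjective x
  obtain ⟨Y, rfl⟩ := isoClass_surjective y
  obtain ⟨Z, rfl⟩ := isoClass_surjective z
  rw [← isoClass_biprod, homCard_isoClass, homCard_isoClass, homCard_isoClass, ← Nat.card_prod]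
  exact Nat.card_congr ⟨fun f => (f ≫ biprod.fst, f ≫ biprod.snd), fun p => biprod.lift p.1 p.2,
    fun f => by ext <;> simp, fun p => by simp⟩

namespace ExactStructure

variable (E : ExactStructure C)

theorem homCard_pos [E.IsFinitary] (x y : IsoClass C) : 0 < homCard x y := by
  have := E.finite_hom x.rep y.rep
  have : Nonempty (x.rep ⟶ y.rep) := ⟨0⟩
  exact Nat.card_pos

/-! ### Short exact sequences and hom numbers -/

variable {E}

theorem card_hom_to_middle {A B X : C} (s : E.Seq A B X) (T : C) :
    Nat.card (T ⟶ X) =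
      Nat.card (Preadditive.rightComp T s.g).range * Nat.card (T ⟶ B) := by
  have := s.conf.mono
  refine card_eq_card_range_mul_card (Preadditive.rightComp T s.f) (Preadditive.rightComp T s.g)
    (fun a b h => (cancel_mono s.f).1 h) (AddSubgroup.ext fun t => ⟨?_, fun ht => ?_⟩)
  · rintro ⟨l, rfl⟩
    change (l ≫ s.f) ≫ s.g = 0
    rw [Category.assoc, s.conf.w, comp_zero]
  · exact s.conf.exists_lift t ht

theorem card_hom_from_middle {A B X : C} (s : E.Seq A B X) (T : C) :
    Nat.card (X ⟶ T) =
      Nat.card (Preadditive.leftComp T s.f).range * Nat.card (A ⟶ T) := by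
  have := s.conf.epi
  refine card_eq_card_range_mul_card (Preadditive.leftComp T s.g) (Preadditive.leftComp T s.f)
    (fun a b h => (cancel_epi s.g).1 h) (AddSubgroup.ext fun t => ⟨?_, fun ht => ?_⟩)
  · rintro ⟨l, rfl⟩
    change s.f ≫ s.g ≫ l = 0
    rw [← Category.assoc, s.conf.w, zero_comp]
  · exact s.conf.exists_desc t ht

theorem homCard_le_of_seq_right [E.IsFinitary] {A B X : C} (s : E.Seq A B X) (t : IsoClass C) :
    homCard t (isoClass X) ≤ homCard t (isoClass A + isoClass B) := by
  obtain ⟨T, rfl⟩ := isoClass_surjective t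
  have := E.finite_hom T A
  rw [homCard_add_right, homCard_isoClass, homCard_isoClass, homCard_isoClass,
    card_hom_to_middle s]
  exact Nat.mul_le_mul_right _ (AddSubgroup.card_le_card_addGroup _)

theorem homCard_le_of_seq_left [E.IsFinitary] {A B X : C} (s : E.Seq A B X) (t : IsoClass C) :
    homCard (isoClass X) t ≤ homCard (isoClass A + isoClass B) t := by
  obtain ⟨T, rfl⟩ := isoClass_surjective t
  have := E.finite_hom B T
  rw [homCard_add_left, homCard_isoClass, homCard_isoClass, homCard_isoClass,
    card_hom_from_middle s, mul_comm]
  exact Nat.mul_le_mul_left _ (AddSubgroup.card_le_card_addGroup _)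

theorem isoClass_eq_add_of_section {A B X : C} (s : E.Seq A B X) (σ : A ⟶ X)
    (hσ : σ ≫ s.g = 𝟙 A) : isoClass X = isoClass A + isoClass B := by
  have := s.conf.mono
  obtain ⟨r, hr⟩ := s.conf.exists_lift (𝟙 X - s.g ≫ σ) (by simp [hσ])
  rw [← isoClass_biprod]
  refine isoClass_eq_iff.2 ⟨⟨biprod.lift s.g r, biprod.desc σ s.f, by simp [hr], ?_⟩⟩
  have h1 : σ ≫ r = 0 := by
    rw [← cancel_mono s.f, Category.assoc, hr, Preadditive.comp_sub, reassoc_of% hσ]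
    simp
  have h2 : s.f ≫ r = 𝟙 B := by
    rw [← cancel_mono s.f, Category.assoc, hr, Preadditive.comp_sub, reassoc_of% s.conf.w]
    simp
  ext <;> simp [hσ, h1, h2, s.conf.w]

/-- The middle term of a short exact sequence has strictly fewer endomorphisms than the direct sum
of the outer terms, unless it is isomorphic to that direct sum. -/
theorem homCard_self_lt_of_seq [E.IsFinitary] {A B X : C} (s : E.Seq A B X)
    (hX : isoClass X ≠ isoClass A + isoClass B) :
    homCard (isoClass X) (isoClass X) <
      homCard (isoClass A + isoClass B) (isoClass A + isoClass B) := by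
  have h1 : homCard (isoClass A) (isoClass X) <
      homCard (isoClass A) (isoClass A + isoClass B) := by
    -- In case of equality every endomorphism of `A` lifts to `X`, in particular the identity.
    refine lt_of_le_of_ne (homCard_le_of_seq_right s _) fun h => hX ?_
    have hpos := E.homCard_pos (isoClass A) (isoClass B)
    rw [homCard_isoClass] at hpos
    rw [homCard_add_right, homCard_isoClass, homCard_isoClass, homCard_isoClass,
      card_hom_to_middle s] at h
    have := E.finite_hom A A
    have htop := AddSubgroup.eq_top_of_card_eq _ (Nat.eq_of_mul_eq_mul_right hpos h)
    obtain ⟨σ, hσ⟩ : 𝟙 A ∈ (Preadditive.rightComp A s.g).range := by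
      rw [htop]; exact AddSubgroup.mem_top _
    exact isoClass_eq_add_of_section s σ hσ
  calc homCard (isoClass X) (isoClass X)
      ≤ homCard (isoClass A + isoClass B) (isoClass X) := homCard_le_of_seq_left s _
    _ = homCard (isoClass A) (isoClass X) * homCard (isoClass B) (isoClass X) :=
        homCard_add_left _ _ _
    _ < homCard (isoClass A) (isoClass A + isoClass B) *
          homCard (isoClass B) (isoClass A + isoClass B) :=
        Nat.mul_lt_mul_of_lt_of_le h1 (homCard_le_of_seq_right s _) (E.homCard_pos _ _)
    _ = _ := (homCard_add_left _ _ _).symm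

variable (E)

theorem exists_conf_toZero (B : C) : E.Conf (𝟙 B) (0 : B ⟶ (0 : C)) := by
  obtain ⟨Z, g, hg⟩ := E.id_inflation B
  have hg : E.Conf (𝟙 B) g := hg
  have := hg.epi
  have hZ : IsZero Z := by
    rw [IsZero.iff_id_eq_zero, ← cancel_epi g, comp_zero, Category.comp_id, ← hg.w,
      Category.id_comp]
  exact hg.congr (Iso.refl B) (Iso.refl B) (hZ.iso (isZero_zero C)) (by simp)
    ((isZero_zero C).eq_of_tgt _ _)

/-- Split sequences belong to every exact structure: the projection `A ⊞ B ⟶ A` is the pullback of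
the deflation `B ⟶ 0`. -/
theorem conf_biprod (A B : C) :
    E.Conf (biprod.inr : B ⟶ A ⊞ B) (biprod.fst : A ⊞ B ⟶ A) := by
  obtain ⟨P, h', g', hP, Q, f, hf⟩ := E.pullback_deflation (0 : B ⟶ (0 : C)) (0 : A ⟶ (0 : C))
    ⟨_, _, E.exists_conf_toZero B⟩
  have hf : E.Conf f g' := hf
  let e : P ≅ A ⊞ B := hP.flip.isoIsPullback A B (IsPullback.of_has_biproduct A B)
  have he : e.hom ≫ biprod.fst = g' := IsPullback.isoIsPullback_hom_fst _ _ _ _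
  have h : E.Conf (f ≫ e.hom) (biprod.fst : A ⊞ B ⟶ A) :=
    hf.congr (Iso.refl Q) e (Iso.refl A) (by simp) (by simp [he])
  refine h.of_kernel (by simp) (f ≫ e.hom ≫ biprod.snd) ?_
  have hw := h.w
  ext
  · simpa using hw.symm
  · simp

end ExactStructure

/-! ### Decomposition into indecomposables -/

/-- An indecomposable class, regarded as an isomorphism class. -/
def IndClass.toIsoClass (i : IndClass C) : IsoClass C := i.1

/-- Every class is a sum of indecomposable ones: non-zero summands of a decomposable object have
fewer endomorphisms than the object. -/
theorem exists_multiset_sum_eq (E : ExactStructure C) [E.IsFinitary] (x : IsoClass C) :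
    ∃ m : Multiset (IndClass C), (m.map IndClass.toIsoClass).sum = x := by
  induction hn : homCard x x using Nat.strong_induction_on generalizing x with
  | _ n ih =>
  subst hn
  obtain ⟨X, rfl⟩ := isoClass_surjective x
  by_cases h0 : IsZero X
  · exact ⟨0, by simpa using (ExactStructure.zero_eq_iff.2 h0).symm⟩
  by_cases hX : Indecomposable X
  · exact ⟨{⟨isoClass X, X, hX, rfl⟩}, Multiset.sum_singleton _⟩
  obtain ⟨Y, Z, e, hY, hZ⟩ : ∃ (Y Z : C) (_ : X ≅ Y ⊞ Z), ¬ IsZero Y ∧ ¬ IsZero Z := by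
    simp only [Indecomposable, not_and, not_forall, not_or] at hX
    obtain ⟨Y, Z, e, h⟩ := hX h0
    exact ⟨Y, Z, e, h⟩
  have two_le : ∀ W : C, ¬ IsZero W → 1 < homCard (isoClass W) (isoClass W) := fun W hW => by
    have := E.finite_hom W W
    rw [homCard_isoClass, Finite.one_lt_card_iff_nontrivial]
    exact ⟨𝟙 W, 0, fun h => hW ((IsZero.iff_id_eq_zero W).2 h)⟩
  have hsum : isoClass X = isoClass Y + isoClass Z := by
    rw [← isoClass_biprod]; exact isoClass_eq_iff.2 ⟨e⟩
  have hcard : homCard (isoClass X) (isoClass X) =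
      (homCard (isoClass Y) (isoClass Y) * homCard (isoClass Y) (isoClass Z)) *
        (homCard (isoClass Z) (isoClass Y) * homCard (isoClass Z) (isoClass Z)) := by
    rw [hsum, homCard_add_left, homCard_add_right, homCard_add_right]
  have hYZ := E.homCard_pos (isoClass Y) (isoClass Z)
  have hZY := E.homCard_pos (isoClass Z) (isoClass Y)
  have hY2 := two_le Y hY
  have hZ2 := two_le Z hZ
  obtain ⟨m, hm⟩ := ih _ (by
    rw [hcard]
    calc _ = (homCard (isoClass Y) (isoClass Y) * 1) * 1 := by simp
      _ < _ := Nat.mul_lt_mul_of_le_of_lt (Nat.mul_le_mul_left _ hYZ)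
        (hZ2.trans_le (Nat.le_mul_of_pos_left _ hZY)) (by positivity)) (isoClass Y) rfl
  obtain ⟨m', hm'⟩ := ih _ (by
    rw [hcard]
    calc _ = 1 * (1 * homCard (isoClass Z) (isoClass Z)) := by simp
      _ < _ := Nat.mul_lt_mul_of_lt_of_le (hY2.trans_le (Nat.le_mul_of_pos_right _ hYZ))
        (Nat.mul_le_mul_right _ hZY) (by positivity)) (isoClass Z) rfl
  exact ⟨m + m', by rw [Multiset.map_add, Multiset.sum_add, hm, hm', hsum]⟩

/-! ### Triangularity of the multiplication -/

theorem IsDominated.add_left (E : ExactStructure C) [E.IsFinitary] {z x : IsoClass C}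
    (h : IsDominated z x) (a : IsoClass C) : IsDominated (a + z) (a + x) where
  left t := by
    simp only [homCard_add_left]
    exact Nat.mul_le_mul_left _ (h.left t)
  right t := by
    simp only [homCard_add_right]
    exact Nat.mul_le_mul_left _ (h.right t)
  self := by
    simp only [homCard_add_left, homCard_add_right]
    exact Nat.mul_lt_mul_of_le_of_lt (Nat.mul_le_mul_left _ (h.left a))
      (Nat.mul_lt_mul_of_le_of_lt (h.right a) h.self (E.homCard_pos _ _))
      (Nat.mul_pos (E.homCard_pos _ _) (E.homCard_pos _ _))

namespace HallAlgebra

variable (E : ExactStructure C)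

/-- The span of the basis elements dominated by `x`. -/
noncomputable def lower (x : IsoClass C) : Submodule ℚ (HallAlgebra E) :=
  Submodule.span ℚ (cls E '' {z | IsDominated z x})

variable {E} in
theorem cls_mem_lower {z x : IsoClass C} (h : IsDominated z x) : cls E z ∈ lower E x :=
  Submodule.subset_span ⟨z, h, rfl⟩

theorem repr_cls_of_ne {z y : IsoClass C} (h : z ≠ y) : (clsBasis E).repr (cls E z) y = 0 := by
  rw [← clsBasis_apply, Module.Basis.repr_self, Finsupp.single_eq_of_ne' h]

/-- A class with at least as many endomorphisms as `x` does not occur in `lower E x`. -/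
theorem repr_lower_eq_zero {x y : IsoClass C} {w : HallAlgebra E} (hw : w ∈ lower E x)
    (hy : homCard x x ≤ homCard y y) : (clsBasis E).repr w y = 0 := by
  change (clsBasis E).coord y w = 0
  have : lower E x ≤ LinearMap.ker ((clsBasis E).coord y) := by
    refine Submodule.span_le.2 ?_
    rintro _ ⟨z, hz, rfl⟩
    refine repr_cls_of_ne E ?_
    rintro rfl
    exact absurd hz.self (not_lt.2 hy)
  exact this hw

variable [E.IsFinitary]

theorem exists_cls_mul_cls_sub_mem_lower (a b : IsoClass C) :
    ∃ c : ℚ, c ≠ 0 ∧ cls E a * cls E b - c • cls E (a + b) ∈ lower E (a + b) := by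
  have hab : a + b ∈ E.extClasses a.rep b.rep := by
    refine ⟨a.rep ⊞ b.rep, ?_, ⟨⟨_, _, E.conf_biprod a.rep b.rep⟩⟩⟩
    rw [isoClass_biprod, isoClass_rep, isoClass_rep]
  refine ⟨E.hallNumber a.rep b.rep (a + b).rep, ?_, ?_⟩
  · rw [Nat.cast_ne_zero, ExactStructure.hallNumber_ne_zero_iff, isoClass_rep]
    exact hab
  classical
  rw [cls_mul_cls, mulCls_eq_sum, ← Finset.add_sum_erase _ _ ((Set.Finite.mem_toFinset _).2 hab),
    add_sub_cancel_left]
  refine Submodule.sum_mem _ fun x hx => Submodule.smul_mem _ _ (cls_mem_lower ?_)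
  rw [Finset.mem_erase, Set.Finite.mem_toFinset] at hx
  obtain ⟨hne, X, rfl, ⟨s⟩⟩ := hx
  rw [← isoClass_rep a, ← isoClass_rep b] at hne ⊢
  exact ⟨ExactStructure.homCard_le_of_seq_left s, ExactStructure.homCard_le_of_seq_right s,
    ExactStructure.homCard_self_lt_of_seq s hne⟩

theorem cls_mul_mem_lower (a : IsoClass C) {x : IsoClass C} {w : HallAlgebra E}
    (hw : w ∈ lower E x) : cls E a * w ∈ lower E (a + x) := by
  have : lower E x ≤ (lower E (a + x)).comap (LinearMap.mulLeft ℚ (cls E a)) := by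
    refine Submodule.span_le.2 ?_
    rintro _ ⟨z, hz, rfl⟩
    have hz' := hz.add_left E a
    obtain ⟨c, -, h⟩ := exists_cls_mul_cls_sub_mem_lower E a z
    have h' : lower E (a + z) ≤ lower E (a + x) :=
      Submodule.span_mono (Set.image_mono fun y hy => IsDominated.trans hy hz')
    have := add_mem (h' h) (Submodule.smul_mem _ c (cls_mem_lower hz'))
    rwa [sub_add_cancel] at this
  exact this hw

/-- A product of basis elements is a non-zero multiple of the class of the direct sum, modulo
classes dominated by it. -/
theorem exists_prod_cls_sub_mem_lower (l : List (IsoClass C)) :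
    ∃ c : ℚ, c ≠ 0 ∧ (l.map (cls E)).prod - c • cls E l.sum ∈ lower E l.sum := by
  induction l with
  | nil => exact ⟨1, one_ne_zero, by simp [one_def]⟩
  | cons a l ih =>
    obtain ⟨c, hc, h⟩ := ih
    obtain ⟨d, hd, h'⟩ := exists_cls_mul_cls_sub_mem_lower E a l.sum
    refine ⟨c * d, mul_ne_zero hc hd, ?_⟩
    have := add_mem (cls_mul_mem_lower E a h) (Submodule.smul_mem _ c h')
    rw [mul_sub, mul_smul_comm, smul_sub, sub_add_sub_cancel, smul_smul] at this
    rwa [List.map_cons, List.prod_cons, List.sum_cons]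

theorem exists_orderedMonomial_sub_mem_lower [LinearOrder (IndClass C)]
    (m : Multiset (IndClass C)) :
    ∃ c : ℚ, c ≠ 0 ∧ orderedMonomial E m - c • cls E (m.map IndClass.toIsoClass).sum ∈
      lower E (m.map IndClass.toIsoClass).sum := by
  have h := exists_prod_cls_sub_mem_lower E ((m.sort (· ≤ ·)).map IndClass.toIsoClass)
  have hs : ((m.sort (· ≤ ·)).map IndClass.toIsoClass).sum = (m.map IndClass.toIsoClass).sum := by
    conv_rhs => rw [← Multiset.sort_eq m (· ≤ ·)]
    rw [Multiset.map_coe, Multiset.sum_coe]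
  rwa [hs, List.map_map] at h

/-! ### Ordered monomials -/

theorem span_orderedMonomial [LinearOrder (IndClass C)] :
    Submodule.span ℚ (Set.range (orderedMonomial E)) = ⊤ := by
  suffices h : ∀ x, cls E x ∈ Submodule.span ℚ (Set.range (orderedMonomial E)) by
    rw [eq_top_iff, ← (clsBasis E).span_eq, Submodule.span_le]
    rintro _ ⟨x, rfl⟩
    exact h x
  intro x
  induction hn : homCard x x using Nat.strong_induction_on generalizing x with
  | _ n ih =>
  subst hn
  obtain ⟨m, rfl⟩ := exists_multiset_sum_eq E x
  obtain ⟨c, hc, h⟩ := exists_orderedMonomial_sub_mem_lower E m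
  have hlow : lower E (m.map IndClass.toIsoClass).sum ≤
      Submodule.span ℚ (Set.range (orderedMonomial E)) := by
    refine Submodule.span_le.2 ?_
    rintro _ ⟨z, hz, rfl⟩
    exact ih _ hz.self z rfl
  have hm : orderedMonomial E m ∈ Submodule.span ℚ (Set.range (orderedMonomial E)) :=
    Submodule.subset_span ⟨m, rfl⟩
  have := sub_mem hm (hlow h)
  rw [sub_sub_cancel] at this
  exact (Submodule.smul_mem_iff _ hc).1 this

/-- If decompositions into indecomposables are unique, then the leading classes of distinct ordered
monomials are distinct, so the ordered monomials are linearly independent. -/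
theorem linearIndependent_orderedMonomial [LinearOrder (IndClass C)]
    (hKS : Function.Injective fun m : Multiset (IndClass C) => (m.map IndClass.toIsoClass).sum) :
    LinearIndependent ℚ (orderedMonomial E) := by
  rw [linearIndependent_iff']
  intro s a hs
  by_contra! hne
  obtain ⟨i, hi, hai⟩ := hne
  let σ : Multiset (IndClass C) → IsoClass C := fun m => (m.map IndClass.toIsoClass).sum
  obtain ⟨m, hm, hmax⟩ := (s.filter (a · ≠ 0)).exists_max_image
    (fun m => homCard (σ m) (σ m)) ⟨i, by simp [hi, hai]⟩
  rw [Finset.mem_filter] at hm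
  -- The class `σ m` occurs in no other monomial of the relation.
  have hcoeff := congrArg (fun w => (clsBasis E).repr w (σ m)) hs
  simp only [map_sum, map_smul, Finsupp.coe_finsetSum, Finset.sum_apply, Finsupp.smul_apply,
    map_zero, Finsupp.zero_apply] at hcoeff
  rw [Finset.sum_eq_single_of_mem m hm.1] at hcoeff
  · obtain ⟨c, hc, h⟩ := exists_orderedMonomial_sub_mem_lower E m
    have h0 := repr_lower_eq_zero E h (le_refl _)
    rw [map_sub, map_smul, ← clsBasis_apply, Module.Basis.repr_self, Finsupp.sub_apply,
      Finsupp.smul_apply, Finsupp.single_eq_same, sub_eq_zero] at h0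
    rw [h0] at hcoeff
    simp [hm.2, hc] at hcoeff
  · intro k hk hkm
    by_cases hak : a k = 0
    · rw [hak, zero_smul]
    obtain ⟨c, hc, h⟩ := exists_orderedMonomial_sub_mem_lower E k
    have h0 := repr_lower_eq_zero E h (hmax k (Finset.mem_filter.2 ⟨hk, hak⟩))
    rw [map_sub, map_smul, Finsupp.sub_apply, Finsupp.smul_apply,
      repr_cls_of_ne E fun h => hkm (hKS h), smul_zero, sub_zero] at h0
    rw [h0, smul_zero]

theorem adjoin_indecomposables :
    Algebra.adjoin ℚ (Set.range fun i : IndClass C => cls E i.1) = ⊤ := by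
  classical
  let _ : LinearOrder (IndClass C) := linearOrderOfSTO WellOrderingRel
  rw [← Algebra.toSubmodule_eq_top, eq_top_iff, ← span_orderedMonomial E, Submodule.span_le]
  rintro _ ⟨m, rfl⟩
  refine Subalgebra.list_prod_mem _ fun y hy => ?_
  obtain ⟨i, -, rfl⟩ := List.mem_map.1 hy
  exact Algebra.subset_adjoin ⟨i, rfl⟩

end HallAlgebra
end HallPBW

theorem mainTheorem3 {C : Type u} [Category.{v} C] [Preadditive C] [HasZeroObject C]
    [HasBinaryBiproducts C] (E : HallPBW.ExactStructure C) [E.IsFinitary] :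
    (∀ [LinearOrder (HallPBW.IndClass C)],
      Submodule.span ℚ (Set.range (HallPBW.HallAlgebra.orderedMonomial E)) = ⊤ ∧
      (HallPBW.IsKrullSchmidt C →
        ∃ b : Module.Basis (Multiset (HallPBW.IndClass C)) ℚ (HallPBW.HallAlgebra E),
          ∀ m, b m = HallPBW.HallAlgebra.orderedMonomial E m)) ∧
    Algebra.adjoin ℚ
      (Set.range fun i : HallPBW.IndClass C => HallPBW.HallAlgebra.cls E i.1) = ⊤ := by
  refine ⟨⟨HallPBW.HallAlgebra.span_orderedMonomial E, fun hKS => ?_⟩,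
    HallPBW.HallAlgebra.adjoin_indecomposables E⟩
  exact ⟨Module.Basis.mk (HallPBW.HallAlgebra.linearIndependent_orderedMonomial E hKS.1)
    (HallPBW.HallAlgebra.span_orderedMonomial E).ge, fun m => Module.Basis.mk_apply _ _ m⟩
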